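/- An operator space is a complex vector space $X$ together with a norm $\|\cdot\|_n$ on each matrix space $\mathbb M_n(X)$, $n\in\mathbb N$, such that $(\mathbb M_1(X),\|\cdot\|_1)$ is a Banach space, $\|x\oplus y\|_{m+n}=\max\{\|x\|_m,\|y\|_n\}$ and $\|\alpha x\beta\|_m\le\|\alpha\|\,\|x\|_m\,\|\beta\|$ for all $m,n\in\mathbb N$, $x\in\mathbb M_m(X)$, $y\in\mathbb M_n(X)$ and $\alpha,\beta\in\mathbb M_m(\mathbb C)$, where $\|\alpha\|$ is the operator norm of $\alpha$ on the Hilbert space $\mathbb C^m$. Let $\mathbf{OS}$ be the category of operator spaces and linear complete contractions, i.e. linear maps $u$ with $\|[u(x_{ij})]\|_n\le\|[x_{ij}]\|_n$ for all $n$ and all $[x_{ij}]\in\mathbb M_n(X)$, let $\mathbf{Ban}$ be the category of complex Banach spaces and linear contractions, and let $U\colon\mathbf{OS}\to\mathbf{Ban}$ be the forgetful functor, which sends $X$ to $X$ with the norm $\|x\|=\|[x]\|_1$. An operator space $X$ is minimal if, for every family of norms $(\|\cdot\|'_n)_n$ that makes the vector space $X$ an operator space with $\|\cdot\|'_1=\|\cdot\|_1$,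 one has $\|\cdot\|_n\le\|\cdot\|'_n$ for all $n$. Let $\mathbf{Min}$ be the full subcategory of $\mathbf{OS}$ on the minimal operator spaces. Then: (1) the restriction of $U$ to $\mathbf{Min}$ is an isomorphism of categories $\mathbf{Min}\cong\mathbf{Ban}$: there is a functor $\mathrm{Min}\colon\mathbf{Ban}\to\mathbf{Min}$ that is strictly inverse to it; (2) $\mathbf{Min}$ is a reflective subcategory of $\mathbf{OS}$, i.e. the inclusion $\mathbf{Min}\hookrightarrow\mathbf{OS}$ has a left adjoint; (3) $\mathbf{Min}$ is closed under countably-directed colimits in $\mathbf{OS}$: if $\Lambda$ is a (small) poset in which every countable subset has an upper bound, $D\colon\Lambda\to\mathbf{OS}$ is a functor all of whose values are minimal operator spaces, and $C$ is a colimit of $D$ in $\mathbf{OS}$, then $C$ is minimal. -/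

import Mathlib

open CategoryTheory CategoryTheory.Limits

universe u

noncomputable section

/-! ### Banach spaces and linear contractions -/

/-- A complex Banach space. -/
structure Ban : Type (u + 1) where
  carrier : Type u
  [normedAddCommGroup : NormedAddCommGroup carrier]
  [normedSpace : NormedSpace ℂ carrier]
  [completeSpace : CompleteSpace carrier]

namespace Ban

attribute [instance] Ban.normedAddCommGroup Ban.normedSpace Ban.completeSpace

/-- A linear contraction between Banach spaces. -/
@[ext]
structure Hom (X Y : Ban.{u}) : Type u where
  toLinearMap : X.carrier →ₗ[ℂ] Y.carrier
  contraction : ∀ x, ‖toLinearMap x‖ ≤ ‖x‖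

/-- The category of complex Banach spaces and linear contractions. -/
instance : Category Ban.{u} where
  Hom := Hom
  id X := ⟨LinearMap.id, fun _ => le_rfl⟩
  comp f g := ⟨g.toLinearMap.comp f.toLinearMap,
    fun x => (g.contraction _).trans (f.contraction x)⟩

end Ban

/-! ### Operator spaces and complete contractions -/

/-- The block diagonal matrix `x ⊕ y` in `M_{m+n}(X)`. -/
def matDirectSum {X : Type u} [AddCommGroup X] {m n : ℕ}
    (x : Matrix (Fin m) (Fin m) X) (y : Matrix (Fin n) (Fin n) X) :
    Matrix (Fin (m + n)) (Fin (m + n)) X :=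
  Matrix.reindex finSumFinEquiv finSumFinEquiv (Matrix.fromBlocks x 0 0 y)

/-- The product `α x β` of a matrix over `X` with scalar matrices on both sides. -/
def matSandwich {X : Type u} [AddCommGroup X] [Module ℂ X] {m : ℕ}
    (α : Matrix (Fin m) (Fin m) ℂ) (x : Matrix (Fin m) (Fin m) X)
    (β : Matrix (Fin m) (Fin m) ℂ) : Matrix (Fin m) (Fin m) X :=
  Matrix.of fun i j => ∑ k, ∑ l, (α i k * β l j) • x k l

/-- The norm of a scalar matrix as an operator on the Hilbert space `ℂᵐ`. -/
def scalarMatNorm {m : ℕ} (α : Matrix (Fin m) (Fin m) ℂ) : ℝ :=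
  ‖Matrix.toEuclideanCLM (n := Fin m) (𝕜 := ℂ) α‖

/-- An operator space structure on a complex vector space: a norm on each matrix space
`M_n(X)`, complete for `n = 1`, such that the two axioms of Ruan hold. -/
@[ext]
structure OSS (X : Type u) [AddCommGroup X] [Module ℂ X] : Type u where
  norm : ∀ n : ℕ, Matrix (Fin n) (Fin n) X → ℝ
  isNorm : ∀ n : ℕ, @NormedSpace.Core ℂ (Matrix (Fin n) (Fin n) X) _ _ _ ⟨norm n⟩
  complete : @CompleteSpace (Matrix (Fin 1) (Fin 1) X)
    (@NormedAddCommGroup.ofCore ℂ (Matrix (Fin 1) (Fin 1) X) _ _ _ ⟨norm 1⟩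
      (isNorm 1)).toMetricSpace.toUniformSpace
  norm_directSum : ∀ {m n : ℕ} (x : Matrix (Fin m) (Fin m) X) (y : Matrix (Fin n) (Fin n) X),
    norm (m + n) (matDirectSum x y) = max (norm m x) (norm n y)
  norm_sandwich : ∀ {m : ℕ} (α : Matrix (Fin m) (Fin m) ℂ) (x : Matrix (Fin m) (Fin m) X)
    (β : Matrix (Fin m) (Fin m) ℂ),
    norm m (matSandwich α x β) ≤ scalarMatNorm α * norm m x * scalarMatNorm β

/-- An (abstract) operator space. -/
structure OS : Type (u + 1) where
  carrier : Type u
  [addCommGroup : AddCommGroup carrier]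
  [module : Module ℂ carrier]
  oss : OSS carrier

namespace OS

attribute [instance] OS.addCommGroup OS.module

/-- A linear complete contraction: every amplification `[x_ij] ↦ [f x_ij]` is a contraction. -/
@[ext]
structure Hom (X Y : OS.{u}) : Type u where
  toLinearMap : X.carrier →ₗ[ℂ] Y.carrier
  completeContraction : ∀ (n : ℕ) (x : Matrix (Fin n) (Fin n) X.carrier),
    Y.oss.norm n (x.map toLinearMap) ≤ X.oss.norm n x

/-- The category of operator spaces and linear complete contractions. -/
instance : Category OS.{u} where
  Hom := Hom
  id X := ⟨LinearMap.id, fun _ _ => le_rfl⟩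
  comp f g := ⟨g.toLinearMap.comp f.toLinearMap,
    fun n x => (g.completeContraction n (x.map f.toLinearMap)).trans (f.completeContraction n x)⟩

end OS

/-! ### The forgetful functor -/

namespace OSS

variable {X : Type u} [AddCommGroup X] [Module ℂ X]

/-- The linear isomorphism `X ≅ M_1(X)`. -/
def toMatOne : X ≃ₗ[ℂ] Matrix (Fin 1) (Fin 1) X where
  toFun x := Matrix.of fun _ _ => x
  invFun a := a 0 0
  map_add' _ _ := rfl
  map_smul' _ _ := rfl
  left_inv _ := rfl
  right_inv a := by
    ext i j
    rw [Subsingleton.elim i 0, Subsingleton.elim j 0]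
    rfl

/-- The norm `‖x‖ = ‖[x]‖₁` on `X` itself. -/
abbrev baseNorm (s : OSS X) : Norm X := ⟨fun x => s.norm 1 (toMatOne x)⟩

theorem baseNorm_core (s : OSS X) : @NormedSpace.Core ℂ X _ _ _ s.baseNorm := by
  let := s.baseNorm
  let : Norm (Matrix (Fin 1) (Fin 1) X) := ⟨s.norm 1⟩
  have h := s.isNorm 1
  exact
    { norm_nonneg := fun x => h.norm_nonneg _
      norm_smul := fun c x => h.norm_smul c (toMatOne x)
      norm_triangle := fun x y => h.norm_triangle (toMatOne x) (toMatOne y)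
      norm_eq_zero_iff := fun x =>
        (h.norm_eq_zero_iff (toMatOne x)).trans toMatOne.map_eq_zero_iff }

/-- `X` as a normed group, with the norm carried over from `M_1(X)`. -/
abbrev baseGroup (s : OSS X) : NormedAddCommGroup X :=
  @NormedAddCommGroup.ofCore ℂ X _ _ _ s.baseNorm s.baseNorm_core

/-- `X` as a normed space, with the norm carried over from `M_1(X)`. -/
abbrev baseSpace (s : OSS X) : @NormedSpace ℂ X _ s.baseGroup.toSeminormedAddCommGroup :=
  @NormedSpace.mk ℂ X _ s.baseGroup.toSeminormedAddCommGroup _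
    fun c x => by
      let := s.baseNorm
      exact (s.baseNorm_core.norm_smul c x).le

theorem base_complete (s : OSS X) :
    @CompleteSpace X s.baseGroup.toMetricSpace.toUniformSpace := by
  let gX := s.baseGroup
  let gM : NormedAddCommGroup (Matrix (Fin 1) (Fin 1) X) :=
    @NormedAddCommGroup.ofCore ℂ (Matrix (Fin 1) (Fin 1) X) _ _ _ ⟨s.norm 1⟩ (s.isNorm 1)
  have hd : ∀ x y : X, @dist _ gM.toDist (toMatOne x) (toMatOne y) = dist x y := fun _ _ => rfl
  let e : @IsometryEquiv X (Matrix (Fin 1) (Fin 1) X) gX.toMetricSpace.toPseudoEMetricSpace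
      gM.toMetricSpace.toPseudoEMetricSpace :=
    @IsometryEquiv.mk _ _ gX.toMetricSpace.toPseudoEMetricSpace
      gM.toMetricSpace.toPseudoEMetricSpace toMatOne.toEquiv
      (@Isometry.of_dist_eq _ _ gX.toMetricSpace.toPseudoMetricSpace
        gM.toMetricSpace.toPseudoMetricSpace _ hd)
  exact (@IsometryEquiv.completeSpace_iff _ _ gX.toMetricSpace.toPseudoEMetricSpace
    gM.toMetricSpace.toPseudoEMetricSpace e).mpr s.complete

end OSS

namespace OS

/-- The forgetful functor, sending an operator space to its underlying Banach space `M_1(X)`. -/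
def forgetBan : OS.{u} ⥤ Ban.{u} where
  obj X := @Ban.mk X.carrier X.oss.baseGroup X.oss.baseSpace X.oss.base_complete
  map {X Y} f := @Ban.Hom.mk
    (@Ban.mk X.carrier X.oss.baseGroup X.oss.baseSpace X.oss.base_complete)
    (@Ban.mk Y.carrier Y.oss.baseGroup Y.oss.baseSpace Y.oss.base_complete)
    f.toLinearMap (fun x => f.completeContraction 1 (OSS.toMatOne x))

/-- An operator space is minimal if its structure is the smallest one among all operator space
structures with the same underlying Banach space. -/
def IsMinimal : ObjectProperty OS.{u} := fun X =>
  ∀ s : OSS X.carrier, (∀ x : Matrix (Fin 1) (Fin 1) X.carrier, s.norm 1 x = X.oss.norm 1 x) →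
    ∀ (n : ℕ) (x : Matrix (Fin n) (Fin n) X.carrier), X.oss.norm n x ≤ s.norm n x

/-- The full subcategory of minimal operator spaces. -/
abbrev MinOS : Type (u + 1) := (IsMinimal.{u}).FullSubcategory

end OS

/-- A poset in which every countable subset has an upper bound. -/
def CountablyDirected (Λ : Type u) [PartialOrder Λ] : Prop :=
  ∀ S : Set Λ, S.Countable → BddAbove S

end

/-!
The minimal operator space structure on a Banach space `X` is usually described through the
functionals in the unit ball of the dual. By the Hahn-Banach theorem its norm on `M_n(X)` has an
intrinsic description: it is the norm of the bilinear map `(ξ, η) ↦ ∑ i j, ξ i • η j • x i j` on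
`ℂⁿ × ℂⁿ` (`OSS.pairing`). This is taken as the definition here (`OSS.min`), and no duality is
needed: Ruan's axioms follow from the Cauchy-Schwarz inequality, and compressing a matrix by a row
`ξ` and a column `η` shows that this structure lies below every other one with the same norm on
`X`. In fact a linear map into `X` which is contractive at the first matrix level is completely
contractive into `Min X` (`OSS.norm_pairing_map_le`). This property carries everything else.

It makes `Min` a functor, strictly inverse to the forgetful functor on minimal spaces, and it says
that `Min ∘ U` is a reflection: maps `Min (U X) ⟶ Y` and maps `X ⟶ Y` with `Y` minimal are both
just the contractions `U X → U Y`.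

For colimits over a countably directed poset, let `L` be the algebraic colimit of the underlying
vector spaces, with the infimum norm. Countable directedness implies that countably many elements
of `L` lift, together with their norms, to one member of the diagram
(`Ban.exists_norm_transition_eq`), so that `L` is a Banach space without any completion
(`Ban.colimit`). As the norm of a bilinear map on `ℂⁿ × ℂⁿ` is determined by its values on a
countable dense set, matrices over `L` also lift with their minimal norm
(`Ban.exists_norm_pairing_transition_le`). If the members `D i` are minimal and `C` is a colimit in
`OS`, it follows that the canonical map `Min L → C` is completely contractive. The universal
property gives `C ⟶ Min L` such that the composite on `C` is the identity, and a retract of a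
minimal space is minimal.
-/

noncomputable section

open scoped Matrix

/-! ### The minimal operator space structure -/

namespace OSS

section Pairing

variable {X Y : Type*} [NormedAddCommGroup X] [NormedSpace ℂ X] [NormedAddCommGroup Y]
  [NormedSpace ℂ Y] {n : ℕ}

/-- The bilinear map `(ξ, η) ↦ ∑ i j, ξ i • η j • x i j` on `ℂⁿ × ℂⁿ` given by a matrix `x`
over `X`. -/
def pairing : Matrix (Fin n) (Fin n) X →ₗ[ℂ]
    EuclideanSpace ℂ (Fin n) →L[ℂ] EuclideanSpace ℂ (Fin n) →L[ℂ] X where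
  toFun x := ∑ i, ∑ j, (EuclideanSpace.proj i).smulRight
    ((EuclideanSpace.proj j).smulRight (x i j))
  map_add' x y := by
    ext ξ η
    simp [Finset.sum_add_distrib]
  map_smul' c x := by
    ext ξ η
    simp [Finset.smul_sum, smul_comm c]

theorem pairing_apply (x : Matrix (Fin n) (Fin n) X) (ξ η : EuclideanSpace ℂ (Fin n)) :
    pairing x ξ η = ∑ i, ∑ j, ξ i • η j • x i j := by
  simp [pairing]

theorem pairing_map (f : X →ₗ[ℂ] Y) (x : Matrix (Fin n) (Fin n) X)
    (ξ η : EuclideanSpace ℂ (Fin n)) : pairing (x.map f) ξ η = f (pairing x ξ η) := by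
  simp [pairing_apply]

theorem pairing_injective :
    Function.Injective (pairing : Matrix (Fin n) (Fin n) X →ₗ[ℂ] _) := by
  rw [injective_iff_map_eq_zero]
  intro x hx
  ext i j
  have := congr($hx (EuclideanSpace.single i 1) (EuclideanSpace.single j 1))
  simpa [pairing_apply, Pi.single_apply] using this

theorem norm_pairing_le_iff {x : Matrix (Fin n) (Fin n) X} {C : ℝ} (hC : 0 ≤ C) :
    ‖pairing x‖ ≤ C ↔ ∀ ξ η, ‖pairing x ξ η‖ ≤ C * ‖ξ‖ * ‖η‖ :=
  ⟨fun h ξ η => ((pairing x).le_opNorm₂ ξ η).trans (by gcongr),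
    fun h => (pairing x).opNorm_le_bound₂ hC h⟩

theorem toMatOne_apply {X : Type*} [AddCommGroup X] [Module ℂ X] (x : X) (i j : Fin 1) :
    toMatOne x i j = x := rfl

/-- The minimal structure induces the given norm on `X`. -/
theorem norm_pairing_toMatOne (x : X) : ‖pairing (toMatOne x)‖ = ‖x‖ := by
  apply le_antisymm
  · rw [norm_pairing_le_iff (norm_nonneg x)]
    intro ξ η
    simp [pairing_apply, toMatOne_apply, norm_smul, EuclideanSpace.norm_eq]
    apply le_of_eq
    ring
  · have := (pairing (toMatOne x)).le_opNorm₂ (EuclideanSpace.single 0 1)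
      (EuclideanSpace.single 0 1)
    simpa [pairing_apply, toMatOne_apply] using this

theorem norm_toLp_transpose_mulVec_le (α : Matrix (Fin n) (Fin n) ℂ)
    (ξ : EuclideanSpace ℂ (Fin n)) :
    ‖WithLp.toLp 2 (αᵀ.mulVec ξ)‖ ≤ scalarMatNorm α * ‖ξ‖ := by
  -- `αᵀ ξ` is the complex conjugate of `α* ξ̄`
  have h1 : ‖WithLp.toLp 2 (αᵀ.mulVec ξ)‖ =
      ‖Matrix.toEuclideanCLM (n := Fin n) (𝕜 := ℂ) (star α) (WithLp.toLp 2 (star ξ.ofLp))‖ := by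
    rw [Matrix.toEuclideanCLM_toLp, EuclideanSpace.norm_eq, EuclideanSpace.norm_eq]
    congr 1
    refine Finset.sum_congr rfl fun i _ => ?_
    congr 1
    rw [← norm_star]
    congr 1
    simp [Matrix.mulVec, dotProduct]
  have h2 : ‖WithLp.toLp 2 (star ξ.ofLp)‖ = ‖ξ‖ := by
    simp [EuclideanSpace.norm_eq]
  rw [h1, ← h2]
  refine (ContinuousLinearMap.le_opNorm _ _).trans_eq ?_
  rw [map_star]
  exact congrArg (· * _) (norm_star (Matrix.toEuclideanCLM (n := Fin n) (𝕜 := ℂ) α))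

theorem norm_toLp_mulVec_le (α : Matrix (Fin n) (Fin n) ℂ) (ξ : EuclideanSpace ℂ (Fin n)) :
    ‖WithLp.toLp 2 (α.mulVec ξ)‖ ≤ scalarMatNorm α * ‖ξ‖ := by
  have := (Matrix.toEuclideanCLM (n := Fin n) (𝕜 := ℂ) α).le_opNorm ξ
  exact this

/-- `α x β` is paired with `ξ` and `η` as `x` is with `αᵀ ξ` and `β η`. -/
theorem pairing_sandwich (α : Matrix (Fin n) (Fin n) ℂ) (x : Matrix (Fin n) (Fin n) X)
    (β : Matrix (Fin n) (Fin n) ℂ) (ξ η : EuclideanSpace ℂ (Fin n)) :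
    pairing (matSandwich α x β) ξ η =
      pairing x (WithLp.toLp 2 (αᵀ.mulVec ξ)) (WithLp.toLp 2 (β.mulVec η)) := by
  have h : ∀ f : Fin n → Fin n → Fin n → Fin n → X,
      ∑ i, ∑ j, ∑ k, ∑ l, f i j k l = ∑ k, ∑ l, ∑ j, ∑ i, f i j k l := fun f => calc
    _ = ∑ i, ∑ k, ∑ l, ∑ j, f i j k l := Finset.sum_congr rfl fun i _ => by
      rw [Finset.sum_comm]
      exact Finset.sum_congr rfl fun k _ => Finset.sum_comm
    _ = ∑ k, ∑ l, ∑ i, ∑ j, f i j k l := by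
      rw [Finset.sum_comm]
      exact Finset.sum_congr rfl fun k _ => Finset.sum_comm
    _ = _ := Finset.sum_congr rfl fun k _ => Finset.sum_congr rfl fun l _ => Finset.sum_comm
  simp only [pairing_apply, matSandwich, Matrix.of_apply, Matrix.mulVec, dotProduct,
    Matrix.transpose_apply, Finset.smul_sum, smul_smul]
  rw [h]
  refine Finset.sum_congr rfl fun k _ => Finset.sum_congr rfl fun l _ => ?_
  rw [Finset.sum_mul_sum, Finset.sum_smul, Finset.sum_comm]
  refine Finset.sum_congr rfl fun i _ => ?_
  rw [Finset.sum_smul]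
  refine Finset.sum_congr rfl fun j _ => ?_
  congr 1
  ring

theorem norm_pairing_sandwich_le (α : Matrix (Fin n) (Fin n) ℂ) (x : Matrix (Fin n) (Fin n) X)
    (β : Matrix (Fin n) (Fin n) ℂ) :
    ‖pairing (matSandwich α x β)‖ ≤ scalarMatNorm α * ‖pairing x‖ * scalarMatNorm β := by
  have hα : 0 ≤ scalarMatNorm α := norm_nonneg _
  have hβ : 0 ≤ scalarMatNorm β := norm_nonneg _
  rw [norm_pairing_le_iff (by positivity)]
  intro ξ η
  rw [pairing_sandwich]
  refine ((pairing x).le_opNorm₂ _ _).trans ?_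
  calc _ ≤ ‖pairing x‖ * (scalarMatNorm α * ‖ξ‖) * (scalarMatNorm β * ‖η‖) := by
        gcongr
        · exact norm_toLp_transpose_mulVec_le α ξ
        · exact norm_toLp_mulVec_le β η
    _ = _ := by ring

theorem pairing_directSum {m : ℕ} (x : Matrix (Fin m) (Fin m) X) (y : Matrix (Fin n) (Fin n) X)
    (ξ η : EuclideanSpace ℂ (Fin (m + n))) :
    pairing (matDirectSum x y) ξ η =
      pairing x (WithLp.toLp 2 fun i => ξ (Fin.castAdd n i))
        (WithLp.toLp 2 fun i => η (Fin.castAdd n i)) +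
      pairing y (WithLp.toLp 2 fun i => ξ (Fin.natAdd m i))
        (WithLp.toLp 2 fun i => η (Fin.natAdd m i)) := by
  simp [pairing_apply, matDirectSum, Fin.sum_univ_add]

theorem norm_sq_eq_add {m : ℕ} (ξ : EuclideanSpace ℂ (Fin (m + n))) :
    ‖ξ‖ ^ 2 = ‖WithLp.toLp 2 fun i => ξ (Fin.castAdd n i)‖ ^ 2 +
      ‖WithLp.toLp 2 fun i => ξ (Fin.natAdd m i)‖ ^ 2 := by
  simp [EuclideanSpace.norm_sq_eq, Fin.sum_univ_add]

theorem norm_pairing_directSum {m : ℕ} (x : Matrix (Fin m) (Fin m) X)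
    (y : Matrix (Fin n) (Fin n) X) :
    ‖pairing (matDirectSum x y)‖ = max ‖pairing x‖ ‖pairing y‖ := by
  apply le_antisymm
  · have hC : 0 ≤ max ‖pairing x‖ ‖pairing y‖ := le_max_of_le_left (norm_nonneg (pairing x))
    refine (norm_pairing_le_iff hC).2 fun ξ η => ?_
    rw [pairing_directSum, mul_assoc]
    refine (norm_add_le_of_le ((pairing x).le_opNorm₂ _ _) ((pairing y).le_opNorm₂ _ _)).trans ?_
    have hξ := norm_sq_eq_add ξ
    have hη := norm_sq_eq_add η
    set a := ‖WithLp.toLp 2 fun i => ξ (Fin.castAdd n i)‖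
    set b := ‖WithLp.toLp 2 fun i => ξ (Fin.natAdd m i)‖
    set c := ‖WithLp.toLp 2 fun i => η (Fin.castAdd n i)‖
    set d := ‖WithLp.toLp 2 fun i => η (Fin.natAdd m i)‖
    -- the Cauchy-Schwarz inequality in `ℝ²`
    have hcs : a * c + b * d ≤ ‖ξ‖ * ‖η‖ := by
      refine (abs_le_of_sq_le_sq' ?_ (by positivity)).2
      rw [mul_pow, hξ, hη]
      nlinarith [sq_nonneg (a * d - b * c)]
    calc _ ≤ max ‖pairing x‖ ‖pairing y‖ * a * c + max ‖pairing x‖ ‖pairing y‖ * b * d := by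
          gcongr
          · exact le_max_left _ _
          · exact le_max_right _ _
      _ = max ‖pairing x‖ ‖pairing y‖ * (a * c + b * d) := by ring
      _ ≤ _ := by gcongr
  · apply max_le
    · refine (norm_pairing_le_iff (norm_nonneg (pairing (matDirectSum x y)))).2 fun ξ η => ?_
      -- vectors extended by zero see only the first block
      have h0 : (WithLp.toLp 2 fun _ => 0 : EuclideanSpace ℂ (Fin n)) = 0 := rfl
      have h := (pairing (matDirectSum x y)).le_opNorm₂
        (WithLp.toLp 2 (Fin.append ξ 0)) (WithLp.toLp 2 (Fin.append η 0))
      simpa [pairing_directSum, EuclideanSpace.norm_eq, Fin.sum_univ_add, h0] using h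
    · refine (norm_pairing_le_iff (norm_nonneg (pairing (matDirectSum x y)))).2 fun ξ η => ?_
      have h0 : (WithLp.toLp 2 fun _ => 0 : EuclideanSpace ℂ (Fin m)) = 0 := rfl
      have h := (pairing (matDirectSum x y)).le_opNorm₂
        (WithLp.toLp 2 (Fin.append 0 ξ)) (WithLp.toLp 2 (Fin.append 0 η))
      simpa [pairing_directSum, EuclideanSpace.norm_eq, Fin.sum_univ_add, h0] using h

end Pairing

section Min

variable (X : Type u) [NormedAddCommGroup X] [NormedSpace ℂ X]

theorem norm_pairing_core (n : ℕ) :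
    @NormedSpace.Core ℂ (Matrix (Fin n) (Fin n) X) _ _ _ ⟨fun x => ‖pairing x‖⟩ :=
  let : Norm (Matrix (Fin n) (Fin n) X) := ⟨fun x => ‖pairing x‖⟩
  { norm_nonneg := fun x => norm_nonneg (pairing x)
    norm_smul := fun c x => by
      change ‖pairing (c • x)‖ = ‖c‖ * ‖pairing x‖
      rw [map_smul]
      exact @norm_smul ℂ _ _ _ _ NormedSpace.toNormSMulClass c (pairing x)
    norm_triangle := fun x y => by
      change ‖pairing (x + y)‖ ≤ ‖pairing x‖ + ‖pairing y‖
      rw [map_add]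
      exact norm_add_le (pairing x) (pairing y)
    norm_eq_zero_iff := fun x =>
      (norm_eq_zero (a := pairing x)).trans (map_eq_zero_iff _ pairing_injective) }

/-- The minimal operator space structure on a Banach space: the norm of a matrix `x` is the norm
of its bilinear form `pairing x`. -/
def min [CompleteSpace X] : OSS X where
  norm n x := ‖pairing x‖
  isNorm n := norm_pairing_core X n
  complete := by
    let gM : NormedAddCommGroup (Matrix (Fin 1) (Fin 1) X) :=
      @NormedAddCommGroup.ofCore ℂ (Matrix (Fin 1) (Fin 1) X) _ _ _ ⟨fun x => ‖pairing x‖⟩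
        (norm_pairing_core X 1)
    have hd : ∀ x y : X, @dist _ gM.toDist (toMatOne x) (toMatOne y) = dist x y := fun x y => by
      refine (@dist_eq_norm _ gM.toSeminormedAddCommGroup _ _).trans ?_
      rw [dist_eq_norm, ← map_sub, ← norm_pairing_toMatOne (x - y)]
      rfl
    let e : @IsometryEquiv X (Matrix (Fin 1) (Fin 1) X) _
        gM.toMetricSpace.toPseudoEMetricSpace :=
      @IsometryEquiv.mk _ _ _ gM.toMetricSpace.toPseudoEMetricSpace toMatOne.toEquiv
        (@Isometry.of_dist_eq _ _ _ gM.toMetricSpace.toPseudoMetricSpace _ hd)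
    exact (@IsometryEquiv.completeSpace_iff _ _ _ gM.toMetricSpace.toPseudoEMetricSpace e).mp
      inferInstance
  norm_directSum x y := norm_pairing_directSum x y
  norm_sandwich α x β := norm_pairing_sandwich_le α x β

end Min

section Comparison

variable {X Y : Type u} [NormedAddCommGroup X] [NormedSpace ℂ X] [AddCommGroup Y] [Module ℂ Y]

protected theorem norm_nonneg (s : OSS Y) {n : ℕ} (x : Matrix (Fin n) (Fin n) Y) : 0 ≤ s.norm n x :=
  by
  let : Norm (Matrix (Fin n) (Fin n) Y) := ⟨s.norm n⟩
  exact (s.isNorm n).norm_nonneg x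

theorem scalarMatNorm_row_le {n : ℕ} (i₀ : Fin n) (ξ : EuclideanSpace ℂ (Fin n)) :
    scalarMatNorm (Matrix.of fun i k => if i = i₀ then ξ k else 0) ≤ ‖ξ‖ := by
  refine ContinuousLinearMap.opNorm_le_bound _ (norm_nonneg ξ) fun v => ?_
  have h : Matrix.toEuclideanCLM (n := Fin n) (𝕜 := ℂ)
      (Matrix.of fun i k => if i = i₀ then ξ k else 0) v =
      EuclideanSpace.single i₀ (inner ℂ (WithLp.toLp 2 (star ξ.ofLp)) v) := by
    ext i
    rw [Matrix.ofLp_toEuclideanCLM]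
    by_cases hi : i = i₀ <;>
      simp [hi, Matrix.mulVec, dotProduct, PiLp.inner_apply, mul_comm]
  have h2 : ‖WithLp.toLp 2 (star ξ.ofLp)‖ = ‖ξ‖ := by
    simp [EuclideanSpace.norm_eq]
  rw [h, PiLp.norm_single, ← h2]
  exact norm_inner_le_norm _ _

theorem scalarMatNorm_col_le {n : ℕ} (i₀ : Fin n) (η : EuclideanSpace ℂ (Fin n)) :
    scalarMatNorm (Matrix.of fun l j => if j = i₀ then η l else 0) ≤ ‖η‖ := by
  refine ContinuousLinearMap.opNorm_le_bound _ (norm_nonneg η) fun v => ?_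
  have h : Matrix.toEuclideanCLM (n := Fin n) (𝕜 := ℂ)
      (Matrix.of fun l j => if j = i₀ then η l else 0) v = v i₀ • η := by
    ext i
    rw [Matrix.ofLp_toEuclideanCLM]
    simp [Matrix.mulVec, dotProduct, mul_comm]
  rw [h, norm_smul, mul_comm]
  gcongr
  exact PiLp.norm_apply_le v i₀

/-- Compressing a matrix by a row and a column: `‖ξ x η‖₁ ≤ ‖ξ‖ ‖x‖ₙ ‖η‖`. -/
theorem norm_sum_smul_le (s : OSS Y) {n : ℕ} (x : Matrix (Fin n) (Fin n) Y)
    (ξ η : EuclideanSpace ℂ (Fin n)) :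
    s.norm 1 (toMatOne (∑ i, ∑ j, ξ i • η j • x i j)) ≤ s.norm n x * ‖ξ‖ * ‖η‖ := by
  obtain rfl | ⟨m, rfl⟩ : n = 0 ∨ ∃ m, n = 1 + m := by
    cases n with
    | zero => exact .inl rfl
    | succ m => exact .inr ⟨m, add_comm _ _⟩
  · let : Norm Y := s.baseNorm
    have h0 : ‖(0 : Y)‖ = 0 := (s.baseNorm_core.norm_eq_zero_iff 0).2 rfl
    have hx : 0 ≤ s.norm 0 x := s.norm_nonneg x
    simp only [Finset.univ_eq_empty, Finset.sum_empty]
    exact h0.le.trans (by positivity)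
  · -- `α` has first row `ξ` and `β` has first column `η`, so that `α x β = [ξ x η] ⊕ 0`
    set α : Matrix (Fin (1 + m)) (Fin (1 + m)) ℂ :=
      Matrix.of fun i k => if i = Fin.castAdd m 0 then ξ k else 0
    set β : Matrix (Fin (1 + m)) (Fin (1 + m)) ℂ :=
      Matrix.of fun l j => if j = Fin.castAdd m 0 then η l else 0
    have h0 : ∀ k : Fin m, Fin.natAdd 1 k ≠ Fin.castAdd m 0 := fun k hk => by
      simp [Fin.ext_iff] at hk
    have h : matSandwich α x β = matDirectSum (toMatOne (∑ i, ∑ j, ξ i • η j • x i j))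
        (0 : Matrix (Fin m) (Fin m) Y) := by
      ext i j
      refine Fin.addCases (fun i => ?_) (fun i => ?_) i <;>
      refine Fin.addCases (fun j => ?_) (fun j => ?_) j
      · rw [Subsingleton.elim i 0, Subsingleton.elim j 0]
        simp [matSandwich, matDirectSum, α, β, toMatOne_apply, smul_smul, -map_sum]
      all_goals simp [matSandwich, matDirectSum, α, β, h0]
    have hx : 0 ≤ s.norm (1 + m) x := s.norm_nonneg x
    calc _ ≤ s.norm (1 + m) (matSandwich α x β) := by
          rw [h, s.norm_directSum]
          exact le_max_left _ _
      _ ≤ scalarMatNorm α * s.norm (1 + m) x * scalarMatNorm β := s.norm_sandwich _ _ _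
      _ ≤ ‖ξ‖ * s.norm (1 + m) x * ‖η‖ := by
          gcongr
          · exact norm_nonneg _
          · exact scalarMatNorm_row_le _ ξ
          · exact scalarMatNorm_col_le _ η
      _ = _ := by ring

/-- A linear map into a Banach space that is contractive at the first matrix level is completely
contractive for the minimal structure on the target. -/
theorem norm_pairing_map_le (s : OSS Y) (f : Y →ₗ[ℂ] X)
    (hf : ∀ y, ‖f y‖ ≤ s.norm 1 (toMatOne y)) {n : ℕ} (x : Matrix (Fin n) (Fin n) Y) :
    ‖pairing (x.map f)‖ ≤ s.norm n x := by
  refine (norm_pairing_le_iff (s.norm_nonneg x)).2 fun ξ η => ?_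
  have h : pairing (x.map f) ξ η = f (∑ i, ∑ j, ξ i • η j • x i j) := by
    simp [pairing_apply]
  rw [h]
  exact (hf _).trans (s.norm_sum_smul_le x ξ η)

end Comparison

end OSS

/-! ### Minimal operator spaces as a category -/

namespace Ban

/-- Two Banach spaces with the same underlying vector space and the same norm are equal: the norm
determines the metric, uniformity and bornology that are part of the structure. -/
theorem mk_congr {X : Type u} {g₁ g₂ : NormedAddCommGroup X}
    {s₁ : @NormedSpace ℂ X _ g₁.toSeminormedAddCommGroup}
    {s₂ : @NormedSpace ℂ X _ g₂.toSeminormedAddCommGroup}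
    {c₁ : @CompleteSpace X g₁.toMetricSpace.toUniformSpace}
    {c₂ : @CompleteSpace X g₂.toMetricSpace.toUniformSpace}
    (hg : g₁.toAddCommGroup = g₂.toAddCommGroup)
    (hs : HEq s₁.toModule s₂.toModule)
    (hn : ∀ x, g₁.toNorm.norm x = g₂.toNorm.norm x) :
    @Ban.mk X g₁ s₁ c₁ = @Ban.mk X g₂ s₂ c₂ := by
  obtain rfl : g₁ = g₂ := by
    have hm : g₁.toMetricSpace = g₂.toMetricSpace := by
      refine MetricSpace.ext ?_
      ext x y
      refine (@dist_eq_norm _ g₁.toSeminormedAddCommGroup x y).trans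
        (Eq.trans ?_ (@dist_eq_norm _ g₂.toSeminormedAddCommGroup x y).symm)
      rw [← hn]
      congr 1
      exact congr(($hg).toSub.sub x y)
    have hN : g₁.toNorm = g₂.toNorm := congrArg Norm.mk (funext hn)
    cases g₁
    cases g₂
    dsimp only at hm hg hN
    subst hm hg hN
    rfl
  obtain rfl : s₁ = s₂ := by
    cases s₁
    cases s₂
    congr 1
    exact eq_of_heq hs
  rfl

theorem eqToHom_toLinearMap {X Y : Ban.{u}} (h : X = Y) (x : X.carrier) :
    Hom.toLinearMap (eqToHom h) x = cast (congrArg carrier h) x := by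
  subst h
  rfl

end Ban

namespace OS

theorem eqToHom_hom_toLinearMap {X Y : MinOS.{u}} (h : X = Y) (x : X.obj.carrier) :
    Hom.toLinearMap (eqToHom h).hom x = cast (congrArg (fun Z => Z.obj.carrier) h) x := by
  subst h
  rfl

/-- A Banach space with its minimal operator space structure. -/
def min (B : Ban.{u}) : OS.{u} := ⟨B.carrier, OSS.min B.carrier⟩

/-- A linear map into a Banach space `B` which is contractive at the first matrix level is a
complete contraction into `Min B`. -/
def homMin {X : OS.{u}} {B : Ban.{u}} (f : X.carrier →ₗ[ℂ] B.carrier)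
    (hf : ∀ x, ‖f x‖ ≤ X.oss.norm 1 (OSS.toMatOne x)) : X ⟶ min B :=
  Hom.mk (X := X) (Y := min B) f fun _ x => X.oss.norm_pairing_map_le f hf x

theorem isMinimal_min (B : Ban.{u}) : IsMinimal (min B) := fun s hs _ x =>
  let t : OSS B.carrier := s
  t.norm_pairing_map_le LinearMap.id
    (fun y => ((hs _).trans (OSS.norm_pairing_toMatOne (X := B.carrier) y)).ge) x

theorem forgetBan_min (B : Ban.{u}) : forgetBan.obj (min B) = B :=
  Ban.mk_congr rfl HEq.rfl fun x => OSS.norm_pairing_toMatOne (X := B.carrier) x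

theorem norm_min_forgetBan_le (X : OS.{u}) (n : ℕ) (x : Matrix (Fin n) (Fin n) X.carrier) :
    (min (forgetBan.obj X)).oss.norm n x ≤ X.oss.norm n x :=
  (homMin (X := X) (B := forgetBan.obj X) LinearMap.id fun _ => le_rfl).completeContraction n x

theorem IsMinimal.norm_min_forgetBan {X : OS.{u}} (hX : IsMinimal X) (n : ℕ)
    (x : Matrix (Fin n) (Fin n) X.carrier) :
    (min (forgetBan.obj X)).oss.norm n x = X.oss.norm n x := by
  refine (norm_min_forgetBan_le X n x).antisymm (hX _ (fun y => ?_) n x)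
  obtain ⟨y, rfl⟩ := OSS.toMatOne.surjective y
  exact OSS.norm_pairing_toMatOne (X := (forgetBan.obj X).carrier) y

theorem IsMinimal.min_forgetBan {X : OS.{u}} (hX : IsMinimal X) : min (forgetBan.obj X) = X := by
  have h : (min (forgetBan.obj X)).oss = X.oss :=
    OSS.ext (funext fun n => funext fun x => hX.norm_min_forgetBan n x)
  exact congrArg (fun s => (⟨X.carrier, s⟩ : OS.{u})) h

/-- The functor sending a Banach space to its minimal operator space structure. -/
def minFunctor : Ban.{u} ⥤ MinOS.{u} where
  obj B := ⟨min B, isMinimal_min B⟩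
  map {A B} f := ObjectProperty.homMk (homMin (X := min A) (B := B) (Ban.Hom.toLinearMap f)
    fun x => (Ban.Hom.contraction f x).trans_eq
      (OSS.norm_pairing_toMatOne (X := A.carrier) x).symm)

theorem minFunctor_comp_forget :
    minFunctor.{u} ⋙ (IsMinimal.{u}.ι ⋙ forgetBan.{u}) = 𝟭 Ban.{u} := by
  refine CategoryTheory.Functor.ext forgetBan_min fun A B f => ?_
  refine Ban.Hom.ext (LinearMap.ext fun x => ?_)
  symm
  refine (Ban.eqToHom_toLinearMap (forgetBan_min B).symm _).trans ?_
  exact congrArg (Ban.Hom.toLinearMap f) (Ban.eqToHom_toLinearMap (forgetBan_min A) x)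

theorem forget_comp_minFunctor :
    (IsMinimal.{u}.ι ⋙ forgetBan.{u}) ⋙ minFunctor.{u} = 𝟭 MinOS.{u} := by
  refine CategoryTheory.Functor.ext
    (fun X => ObjectProperty.FullSubcategory.ext X.property.min_forgetBan) fun X Y f => ?_
  refine ObjectProperty.hom_ext _ (OS.Hom.ext (LinearMap.ext fun x => ?_))
  symm
  refine (eqToHom_hom_toLinearMap _ _).trans ?_
  exact congrArg (Hom.toLinearMap f.hom) (eqToHom_hom_toLinearMap _ x)

/-- The reflection of operator spaces onto minimal ones, `X ↦ Min (U X)`: both hom-sets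
`Min (U X) ⟶ Y` and `X ⟶ Y` consist of the linear contractions `U X → U Y`. -/
def minAdjunction : (forgetBan.{u} ⋙ minFunctor.{u}) ⊣ IsMinimal.{u}.ι :=
  Adjunction.mkOfHomEquiv
    { homEquiv := fun X Y =>
        { toFun := fun f => Hom.mk (X := X) (Y := Y.obj)
            (Hom.toLinearMap (X := min (forgetBan.obj X)) f.hom) fun n x =>
              (Hom.completeContraction f.hom n x).trans (norm_min_forgetBan_le X n x)
          invFun := fun g => ObjectProperty.homMk (Hom.mk (X := min (forgetBan.obj X))
            (Y := Y.obj) (Hom.toLinearMap (X := X) (Y := Y.obj) g) fun n x =>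
              (Y.property.norm_min_forgetBan n _).ge.trans
                (Hom.completeContraction (minFunctor.map (forgetBan.map g)).hom n x))
          left_inv := fun _ => rfl
          right_inv := fun _ => rfl }
      homEquiv_naturality_left_symm := fun _ _ => rfl
      homEquiv_naturality_right := fun _ _ => rfl }

end OS

/-! ### Countably directed posets -/

theorem CountablyDirected.exists_forall_le {Λ : Type u} [PartialOrder Λ] (hΛ : CountablyDirected Λ)
    {κ : Type*} [Countable κ] (f : κ → Λ) : ∃ j, ∀ k, f k ≤ j := by
  obtain ⟨j, hj⟩ := hΛ (Set.range f) (Set.countable_range f)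
  exact ⟨j, fun k => hj ⟨k, rfl⟩⟩

theorem CountablyDirected.nonempty {Λ : Type u} [PartialOrder Λ] (hΛ : CountablyDirected Λ) :
    Nonempty Λ :=
  (hΛ.exists_forall_le Empty.elim).nonempty

theorem CountablyDirected.isDirectedOrder {Λ : Type u} [PartialOrder Λ]
    (hΛ : CountablyDirected Λ) : IsDirectedOrder Λ where
  directed i j := by
    obtain ⟨k, hk⟩ := hΛ.exists_forall_le (fun b : Bool => cond b i j)
    exact ⟨k, hk true, hk false⟩

/-! ### Countably directed colimits of Banach spaces -/

namespace Ban

variable {Λ : Type u} [PartialOrder Λ] (F : Λ ⥤ Ban.{u})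

/-- The transition maps of a diagram of Banach spaces. -/
def transition (i j : Λ) (h : i ≤ j) : (F.obj i).carrier →ₗ[ℂ] (F.obj j).carrier :=
  Hom.toLinearMap (F.map (homOfLE h))

theorem norm_transition_le {i j : Λ} (h : i ≤ j) (x : (F.obj i).carrier) :
    ‖transition F i j h x‖ ≤ ‖x‖ :=
  Hom.contraction (F.map (homOfLE h)) x

instance directedSystem :
    DirectedSystem (fun i => (F.obj i).carrier) (fun i j h => transition F i j h) where
  map_self i x := congr(Hom.toLinearMap $(F.map_id i) x)
  map_map {_ _ _} hij hjk x :=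
    congr(Hom.toLinearMap $(F.map_comp (homOfLE hij) (homOfLE hjk)) x).symm

/-- The colimit of the vector spaces underlying a diagram of Banach spaces. -/
abbrev AlgColimit : Type u :=
  letI := Classical.decEq Λ
  Module.DirectLimit (fun i => (F.obj i).carrier) (transition F)

/-- The canonical map of a member of the diagram into the colimit. -/
def toColimit (i : Λ) : (F.obj i).carrier →ₗ[ℂ] AlgColimit F :=
  letI := Classical.decEq Λ
  Module.DirectLimit.of ℂ Λ (fun i => (F.obj i).carrier) (transition F) i

theorem transition_transition {i j k : Λ} (hij : i ≤ j) (hjk : j ≤ k) (x : (F.obj i).carrier) :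
    transition F j k hjk (transition F i j hij x) = transition F i k (hij.trans hjk) x :=
  (directedSystem F).map_map hij hjk x

theorem toColimit_transition {i j : Λ} (h : i ≤ j) (x : (F.obj i).carrier) :
    toColimit F j (transition F i j h x) = toColimit F i x :=
  letI := Classical.decEq Λ
  Module.DirectLimit.of_f

/-- The norm of an element of the colimit is the infimum of the norms of its representatives. -/
instance colimitNorm : Norm (AlgColimit F) where
  norm v := sInf {r | ∃ i x, toColimit F i x = v ∧ ‖x‖ = r}

theorem norm_toColimit_le {i : Λ} (x : (F.obj i).carrier) : ‖toColimit F i x‖ ≤ ‖x‖ := by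
  refine csInf_le ⟨0, ?_⟩ ⟨i, x, rfl, rfl⟩
  rintro _ ⟨j, y, -, rfl⟩
  exact norm_nonneg y

variable {F}

/-- Countably many elements of the colimit have representatives at a common stage. -/
theorem exists_toColimit_eq_of_countable (hΛ : CountablyDirected Λ) {κ : Type*} [Countable κ]
    (v : κ → AlgColimit F) :
    ∃ (i : Λ) (x : κ → (F.obj i).carrier), ∀ k, toColimit F i (x k) = v k := by
  let := Classical.decEq Λ
  have := hΛ.nonempty
  have := hΛ.isDirectedOrder
  choose i x hx using fun k => Module.DirectLimit.exists_of (v k)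
  obtain ⟨j, hj⟩ := hΛ.exists_forall_le i
  exact ⟨j, fun k => transition F (i k) j (hj k) (x k), fun k =>
    (toColimit_transition F (hj k) (x k)).trans (hx k)⟩

/-- The infimum defining the norm of the colimit is attained at some stage. -/
theorem exists_norm_transition_le (hΛ : CountablyDirected Λ) {i : Λ} (x : (F.obj i).carrier) :
    ∃ (j : Λ) (h : i ≤ j), ‖transition F i j h x‖ ≤ ‖toColimit F i x‖ := by
  let := Classical.decEq Λ
  have := hΛ.nonempty
  have := hΛ.isDirectedOrder
  set S : Set ℝ := {r | ∃ k y, toColimit F k y = toColimit F i x ∧ ‖y‖ = r} with hS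
  obtain ⟨r, -, hr, hrS⟩ := exists_seq_tendsto_sInf (S := S) ⟨_, i, x, rfl, rfl⟩ ⟨0, by
    rintro _ ⟨j, y, -, rfl⟩
    exact norm_nonneg y⟩
  choose k y hy hyr using hrS
  -- the `m`-th representative agrees with `x` from some stage `l m` on
  have h1 : ∀ m, ∃ l, ∃ (hi : i ≤ l) (hk : k m ≤ l),
      transition F i l hi x = transition F (k m) l hk (y m) := fun m => by
    obtain ⟨a, hia, hka⟩ := exists_ge_ge i (k m)
    have h2 : toColimit F a (transition F i a hia x - transition F (k m) a hka (y m)) = 0 := by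
      rw [map_sub, toColimit_transition, toColimit_transition, hy, sub_self]
    obtain ⟨l, hal, hl⟩ := Module.DirectLimit.of.zero_exact h2
    refine ⟨l, hia.trans hal, hka.trans hal, ?_⟩
    rw [map_sub, sub_eq_zero] at hl
    rwa [transition_transition, transition_transition] at hl
  choose l hi hk hl using h1
  obtain ⟨j, hj⟩ := hΛ.exists_forall_le l
  have hij : i ≤ j := (hi 0).trans (hj 0)
  refine ⟨j, hij, ge_of_tendsto' hr fun m => ?_⟩
  rw [← hyr m]
  rw [← transition_transition F (hi m) (hj m), hl m]
  exact (norm_transition_le F _ _).trans (norm_transition_le F _ _)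

/-- Countably many vectors have, at a common later stage, the norm of their image in the
colimit. -/
theorem exists_norm_transition_eq (hΛ : CountablyDirected Λ) {κ : Type*} [Countable κ] {i : Λ}
    (x : κ → (F.obj i).carrier) :
    ∃ (j : Λ) (h : i ≤ j), ∀ k, ‖transition F i j h (x k)‖ = ‖toColimit F i (x k)‖ := by
  choose l hl hx using fun k => exists_norm_transition_le hΛ (x k)
  obtain ⟨j, hj⟩ := hΛ.exists_forall_le (fun k : Option κ => k.elim i l)
  have hij : i ≤ j := hj none
  refine ⟨j, hij, fun k => le_antisymm ?_ ?_⟩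
  · refine le_trans ?_ (hx k)
    rw [← transition_transition F (hl k) (hj (some k))]
    exact norm_transition_le F _ _
  · rw [← toColimit_transition F hij]
    exact norm_toColimit_le F _

theorem colimitNorm_core (hΛ : CountablyDirected Λ) : NormedSpace.Core ℂ (AlgColimit F) where
  norm_nonneg v := Real.sInf_nonneg (by
    rintro _ ⟨j, y, -, rfl⟩
    exact norm_nonneg y)
  norm_smul c v := by
    obtain ⟨i, x, hx⟩ := exists_toColimit_eq_of_countable hΛ (fun _ : Unit => v)
    obtain ⟨j, h, hj⟩ := exists_norm_transition_eq hΛ (fun b : Bool => cond b (x ()) (c • x ()))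
    have h1 := hj true
    have h2 := hj false
    simp only [cond_true, cond_false, map_smul, hx] at h1 h2
    rw [← h1, ← h2, norm_smul]
  norm_triangle v w := by
    obtain ⟨i, x, hx⟩ := exists_toColimit_eq_of_countable hΛ (fun b : Bool => cond b v w)
    obtain ⟨j, h, hj⟩ := exists_norm_transition_eq hΛ x
    have h1 := hj true
    have h2 := hj false
    have hv := hx true
    have hw := hx false
    simp only [cond_true, cond_false] at hv hw
    rw [← hv, ← hw, ← h1, ← h2, ← map_add, ← toColimit_transition F h, map_add]
    exact (norm_toColimit_le F _).trans (norm_add_le _ _)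
  norm_eq_zero_iff v := by
    obtain ⟨i, x, hx⟩ := exists_toColimit_eq_of_countable hΛ (fun _ : Unit => v)
    obtain ⟨j, h, hj⟩ := exists_norm_transition_eq hΛ (fun b : Bool => cond b (x ()) 0)
    obtain rfl := hx ()
    refine ⟨fun h0 => ?_, fun h0 => ?_⟩
    · have h1 := hj true
      rw [cond_true, h0, norm_eq_zero] at h1
      rw [← toColimit_transition F h, h1, map_zero]
    · have h1 := hj false
      rw [cond_false, map_zero, map_zero, norm_zero] at h1
      rw [h0, ← h1]

/-- The colimit of a countably directed diagram of Banach spaces. It needs no completion: a Cauchy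
sequence lifts, with the same distances between its terms, to a single member of the diagram. -/
def colimit (F : Λ ⥤ Ban.{u}) (hΛ : CountablyDirected Λ) : Ban.{u} :=
  letI g : NormedAddCommGroup (AlgColimit F) := .ofCore (colimitNorm_core hΛ)
  letI : NormedSpace ℂ (AlgColimit F) := .ofCore (colimitNorm_core hΛ)
  haveI : CompleteSpace (AlgColimit F) := by
    refine Metric.complete_of_cauchySeq_tendsto fun v hv => ?_
    obtain ⟨i, x, hx⟩ := exists_toColimit_eq_of_countable hΛ v
    obtain ⟨j, h, hj⟩ := exists_norm_transition_eq hΛ (fun p : ℕ × ℕ => x p.1 - x p.2)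
    have hd : ∀ m n, dist (transition F i j h (x m)) (transition F i j h (x n)) =
        dist (v m) (v n) := fun m n => by
      rw [dist_eq_norm, dist_eq_norm, ← map_sub, hj (m, n), map_sub, hx, hx]
    have hc : CauchySeq fun m => transition F i j h (x m) := by
      rw [Metric.cauchySeq_iff] at hv ⊢
      simpa only [hd] using hv
    obtain ⟨y, hy⟩ := cauchySeq_tendsto_of_complete hc
    refine ⟨toColimit F j y, ?_⟩
    rw [tendsto_iff_dist_tendsto_zero] at hy ⊢
    refine squeeze_zero (fun _ => dist_nonneg) (fun m => ?_) hy
    rw [dist_eq_norm, dist_eq_norm, ← hx m, ← toColimit_transition F h, ← map_sub]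
    exact norm_toColimit_le F _
  ⟨AlgColimit F⟩

/-- The minimal norm that a matrix over a member of the diagram has in the colimit is attained at a
later stage: as `ℂⁿ × ℂⁿ` is separable, it is determined by the norms of countably many vectors. -/
theorem exists_norm_pairing_transition_le (hΛ : CountablyDirected Λ) {i : Λ} {n : ℕ}
    (x : Matrix (Fin n) (Fin n) (F.obj i).carrier) :
    ∃ (j : Λ) (h : i ≤ j), ‖OSS.pairing (x.map (transition F i j h))‖ ≤
      ‖OSS.pairing (X := (colimit F hΛ).carrier) (x.map (toColimit F i))‖ := by
  let L := colimit F hΛ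
  let f : (F.obj i).carrier →ₗ[ℂ] L.carrier := toColimit F i
  let d := TopologicalSpace.denseSeq (EuclideanSpace ℂ (Fin n) × EuclideanSpace ℂ (Fin n))
  obtain ⟨j, h, hj⟩ := exists_norm_transition_eq hΛ
    (fun m : ℕ => OSS.pairing x (d m).1 (d m).2)
  refine ⟨j, h, ?_⟩
  have key : ∀ p : EuclideanSpace ℂ (Fin n) × EuclideanSpace ℂ (Fin n),
      ‖OSS.pairing (x.map (transition F i j h)) p.1 p.2‖ = ‖OSS.pairing (x.map f) p.1 p.2‖ := by
    refine congrFun (Continuous.ext_on (TopologicalSpace.denseRange_denseSeq _)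
      (by fun_prop) (by fun_prop) ?_)
    rintro _ ⟨m, rfl⟩
    dsimp only
    rw [OSS.pairing_map, OSS.pairing_map]
    exact hj m
  refine (OSS.norm_pairing_le_iff (norm_nonneg (OSS.pairing (x.map f)))).2 fun ξ η => ?_
  rw [key (ξ, η)]
  exact (OSS.pairing (x.map f)).le_opNorm₂ ξ η

end Ban

/-! ### Countably directed colimits of minimal operator spaces -/

namespace OS

variable {Λ : Type u} [PartialOrder Λ]

/-- A colimit in `OS` of a countably directed diagram of minimal spaces is a retract of `Min L`,
where `L` is the colimit of the underlying Banach spaces. -/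
theorem isMinimal_of_isColimit (hΛ : CountablyDirected Λ) {D : Λ ⥤ OS.{u}}
    (hD : ∀ i, IsMinimal (D.obj i)) {c : Cocone D} (hc : IsColimit c) : IsMinimal c.pt := by
  let F := D ⋙ forgetBan
  let L := Ban.colimit F hΛ
  let C : OS := c.pt
  let leg (i : Λ) : (F.obj i).carrier →ₗ[ℂ] C.carrier := Hom.toLinearMap (c.ι.app i)
  let cL : Cocone D :=
    { pt := min L
      ι :=
        { app := fun i => homMin (X := D.obj i) (B := L) (Ban.toColimit F i)
            (Ban.norm_toColimit_le F)
          naturality := fun i j h => OS.Hom.ext (LinearMap.ext fun x =>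
            Ban.toColimit_transition F (leOfHom h) x) } }
  let f : C ⟶ min L := hc.desc cL
  let g : L.carrier →ₗ[ℂ] C.carrier :=
    letI := Classical.decEq Λ
    Module.DirectLimit.lift ℂ Λ (fun i => (F.obj i).carrier) (Ban.transition F) leg
      fun i j h x => congr(Hom.toLinearMap $(c.w (homOfLE h)) x)
  have hg : ∀ i x, g (Ban.toColimit F i x) = leg i x := fun i x =>
    letI := Classical.decEq Λ
    Module.DirectLimit.lift_of _ _ _
  -- every matrix over `L` lifts to some `D i` without increasing its norm
  have hgc : ∀ (n : ℕ) (v : Matrix (Fin n) (Fin n) L.carrier),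
      C.oss.norm n (v.map g) ≤ ‖OSS.pairing v‖ := fun n v => by
    obtain ⟨i, x, hx⟩ := Ban.exists_toColimit_eq_of_countable hΛ
      (fun p : Fin n × Fin n => (v p.1 p.2 : Ban.AlgColimit F))
    let w : Matrix (Fin n) (Fin n) (F.obj i).carrier := Matrix.of fun a b => x (a, b)
    have hw : w.map (Ban.toColimit F i) = v := Matrix.ext fun a b => hx (a, b)
    obtain ⟨j, h, hj⟩ := Ban.exists_norm_pairing_transition_le hΛ w
    have hv : v.map g = (w.map (Ban.transition F i j h)).map (leg j) := Matrix.ext fun a b => by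
      refine (congrArg g (hx (a, b))).symm.trans ?_
      rw [← Ban.toColimit_transition F h]
      exact hg j _
    replace hj := hj.trans_eq (congrArg (fun y => ‖OSS.pairing (X := L.carrier) y‖) hw)
    rw [hv]
    refine (Hom.completeContraction (c.ι.app j) n _).trans (le_trans ?_ hj)
    exact ((hD j).norm_min_forgetBan n _).ge
  let gHom : min L ⟶ C := Hom.mk (X := min L) (Y := C) g hgc
  have hgf : f ≫ gHom = 𝟙 C := hc.hom_ext fun i => by
    rw [← Category.assoc, hc.fac, Category.comp_id]
    exact OS.Hom.ext (LinearMap.ext fun x => hg i x)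
  -- any structure `s` with the first norm of `C` makes `f` a complete contraction into `Min L`
  intro s hs n v
  let t : OSS C.carrier := s
  let fl : C.carrier →ₗ[ℂ] L.carrier := Hom.toLinearMap f
  have hfl : ∀ y, ‖fl y‖ ≤ t.norm 1 (OSS.toMatOne y) := fun y => by
    refine le_trans ?_ (hs _).ge
    exact (OSS.norm_pairing_toMatOne (X := L.carrier) (fl y)).ge.trans
      (Hom.completeContraction f 1 (OSS.toMatOne y))
  have hv : (v.map fl).map g = v := Matrix.ext fun a b =>
    congr(Hom.toLinearMap $hgf (v a b))
  calc C.oss.norm n v = C.oss.norm n ((v.map fl).map g) := by rw [hv]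
    _ ≤ ‖OSS.pairing (v.map fl)‖ := hgc n _
    _ ≤ t.norm n v := t.norm_pairing_map_le fl hfl v

end OS

end

theorem mainTheorem6 :
    -- the forgetful functor restricts to an isomorphism from the minimal spaces onto `Ban`
    (∃ M : Ban.{u} ⥤ OS.MinOS.{u},
      M ⋙ (OS.IsMinimal.{u}.ι ⋙ OS.forgetBan.{u}) = 𝟭 Ban.{u} ∧
      (OS.IsMinimal.{u}.ι ⋙ OS.forgetBan.{u}) ⋙ M = 𝟭 OS.MinOS.{u}) ∧
    -- the inclusion of the minimal spaces is fully faithful with a left adjoint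
    Nonempty (Reflective OS.IsMinimal.{u}.ι) ∧
    -- colimits in `OS` of countably directed diagrams of minimal spaces are minimal
    (∀ (Λ : Type u) [PartialOrder Λ], CountablyDirected Λ →
      OS.IsMinimal.{u}.IsClosedUnderColimitsOfShape Λ) := by
  refine ⟨⟨OS.minFunctor, OS.minFunctor_comp_forget, OS.forget_comp_minFunctor⟩,
    ⟨{ L := OS.forgetBan ⋙ OS.minFunctor, adj := OS.minAdjunction }⟩, fun Λ _ hΛ => ⟨?_⟩⟩
  rintro C ⟨p⟩
  exact OS.isMinimal_of_isColimit hΛ p.prop_diag_obj p.isColimit
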